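/- Let $k$ be a field and let $G$ be a finite simple graph with vertex set $V$ and edge set $E(G)$. For an integer $d\ge 1$ let $$L_G(d)=\Big(\textstyle\sum_{\ell=1}^{d}x_{i\ell}x_{j\ell}\ :\ \{i,j\}\in E(G)\Big)\subseteq k[x_{i\ell}\mid i\in V,\ 1\le \ell\le d]$$ be the Lovász–Saks–Schrijver ideal of $G$, and let $\Delta(G)$ be the maximum degree of $G$. An ideal is called a complete intersection if its minimal number of generators equals its height. A positive matching of a graph is a set $M$ of pairwise disjoint edges for which there is a function $w\colon V\to\mathbb R$ with $w(i)+w(j)>0$ for every edge $\{i,j\}\in M$ and $w(i)+w(j)<0$ for every edge $\{i,j\}\notin M$. Let $\mathrm{pmd}(G)$ be the least $p$ such that $E(G)$ is a disjoint union $M_1\cup\dots\cup M_p$ in which each $M_i$ is a positive matching of the graph $(V,E(G)\setminus\bigcup_{j<i}M_j)$. (a) If $G$ is unicyclic, i.e. $G$ contains precisely one cycle as a subgraph, then for every $d\ge 3$ the ideal $L_G(d)$ is a complete intersection if and only if $d\ge\Delta(G)$; in this case $L_G(d)$ is moreover radical. Furthermore $\mathrm{pmd}(G)\le\max\{3,\Delta(G)\}$.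 (b) If $G$ is bicyclic, i.e. $G$ contains exactly two cycles as subgraphs, or, more generally, $|E(G)|-|V|+c(G)=2$, where $c(G)$ is the number of connected components of $G$, then for every $d\ge 4$ the ideal $L_G(d)$ is a complete intersection if and only if $d\ge\Delta(G)$; in this case $L_G(d)$ is moreover radical. Furthermore $\mathrm{pmd}(G)\le\max\{4,\Delta(G)\}$. -/

import Mathlib

/-- A subgraph `H` of `G` is a cycle if it is the subgraph traced out by a cycle (a closed walk of
length at least `3` without repeated vertices or edges). The subgraph does not depend on the
starting vertex or the orientation of the walk. -/
def IsCycleSubgraph {V : Type*} {G : SimpleGraph V} (H : G.Subgraph) : Prop :=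
  ∃ (v : V) (p : G.Walk v v), p.IsCycle ∧ p.toSubgraph = H

/-- `G` contains precisely one cycle as a subgraph. -/
def IsUnicyclic {V : Type*} (G : SimpleGraph V) : Prop :=
  {H : G.Subgraph | IsCycleSubgraph H}.ncard = 1

/-- `G` contains exactly two cycles as subgraphs. -/
def IsBicyclic {V : Type*} (G : SimpleGraph V) : Prop :=
  {H : G.Subgraph | IsCycleSubgraph H}.ncard = 2

/-- `|E(G)| - |V(G)| + c(G) = 2` for a finite graph `G` with `c(G)` connected components. Besides
the graphs with exactly two cycles this holds for the graphs in which two cycles share an edge and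
thereby produce a third one, such as the complete bipartite graph `K_{2,3}`. -/
def HasCyclomaticNumberTwo {V : Type*} (G : SimpleGraph V) : Prop :=
  Nat.card G.edgeSet + Nat.card G.ConnectedComponent = Nat.card V + 2

/-- A set `M` of pairwise disjoint edges of `G` is a positive matching if there is a weight function
on the vertices whose sum over an edge is positive on `M` and negative on all other edges. -/
structure IsPositiveMatching {V : Type*} (G : SimpleGraph V) (M : Set (Sym2 V)) : Prop where
  subset_edgeSet : M ⊆ G.edgeSet
  pairwise_disjoint : ∀ e ∈ M, ∀ f ∈ M, e ≠ f → ∀ v : V, v ∈ e → v ∉ f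
  exists_weight : ∃ w : V → ℝ,
    (∀ i j : V, s(i, j) ∈ M → 0 < w i + w j) ∧
    (∀ i j : V, G.Adj i j → s(i, j) ∉ M → w i + w j < 0)

/-- A partition of `E(G)` into `M 0, …, M (p - 1)` such that each `M i` is a positive matching of
the graph obtained from `G` by deleting the edges in the earlier parts. -/
structure IsPMDecomposition {V : Type*} (G : SimpleGraph V) (p : ℕ) (M : Fin p → Set (Sym2 V)) :
    Prop where
  iUnion_eq : ⋃ i, M i = G.edgeSet
  pairwise_disjoint : ∀ i j, i ≠ j → Disjoint (M i) (M j)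
  isPositiveMatching : ∀ i,
    IsPositiveMatching (G.deleteEdges (⋃ j : Fin p, ⋃ _ : j < i, M j)) (M i)

/-- The positive matching decomposition number of a graph. -/
noncomputable def pmd {V : Type*} (G : SimpleGraph V) : ℕ :=
  sInf {p : ℕ | ∃ M : Fin p → Set (Sym2 V), IsPMDecomposition G p M}

/-- A finite graph has a positive matching decomposition, so the infimum above is attained. -/
theorem exists_isPMDecomposition {V : Type*} [Finite V] (G : SimpleGraph V) :
    ∃ (p : ℕ) (M : Fin p → Set (Sym2 V)), IsPMDecomposition G p M := by
  classical
  obtain ⟨p, ⟨φ⟩⟩ := Finite.exists_equiv_fin G.edgeSet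
  refine ⟨p, fun i => {(φ.symm i : Sym2 V)}, ?_, ?_, ?_⟩
  · ext e
    simp only [Set.mem_iUnion, Set.mem_singleton_iff]
    constructor
    · rintro ⟨i, rfl⟩
      exact (φ.symm i).2
    · intro he
      exact ⟨φ ⟨e, he⟩, by simp⟩
  · intro i j hij
    rw [Set.disjoint_singleton]
    exact fun h => hij (φ.symm.injective (Subtype.ext h))
  · intro i
    refine ⟨?_, ?_, ?_⟩
    · rintro e rfl
      rw [SimpleGraph.edgeSet_deleteEdges]
      refine ⟨(φ.symm i).2, ?_⟩
      simp only [Set.mem_iUnion, Set.mem_singleton_iff, not_exists]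
      intro j hj h
      exact hj.ne' (φ.symm.injective (Subtype.ext h))
    · rintro e rfl f rfl h
      exact absurd rfl h
    · refine ⟨fun v => if v ∈ (φ.symm i : Sym2 V) then 1 else -2, ?_, ?_⟩
      · intro a b h
        rw [Set.mem_singleton_iff] at h
        simp only [← h, Sym2.mem_mk_left, Sym2.mem_mk_right, if_true]
        norm_num
      · intro a b hab h
        rw [Set.mem_singleton_iff] at h
        have hne : a ≠ b := hab.ne
        have : ¬ (a ∈ (φ.symm i : Sym2 V) ∧ b ∈ (φ.symm i : Sym2 V)) := fun hh =>
          h ((Sym2.mem_and_mem_iff hne).1 hh).symm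
        dsimp only
        split_ifs with h1 h2 h2
        · exact absurd ⟨h1, h2⟩ this
        all_goals norm_num

open MvPolynomial in
/-- The Lovász–Saks–Schrijver ideal of `G`: the ideal of `k[x_{iℓ} | i ∈ V(G), 1 ≤ ℓ ≤ d]` generated
by the polynomials `∑ ℓ, x_{iℓ} x_{jℓ}` for the edges `{i, j}` of `G`. -/
noncomputable def lssIdeal (k : Type*) [Field k] {V : Type*} (G : SimpleGraph V) (d : ℕ) :
    Ideal (MvPolynomial (V × Fin d) k) :=
  Ideal.span {f | ∃ i j : V, G.Adj i j ∧ f = ∑ l : Fin d, X (i, l) * X (j, l)}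

/-- An ideal is a complete intersection if its minimal number of generators is its height. -/
def IsCompleteIntersectionIdeal {R : Type*} [CommRing R] (I : Ideal R) : Prop :=
  I.spanRank.toENat = I.height

/-!
The theorem splits into a combinatorial bound and a Gröbner basis argument.

*Combinatorics.* A decomposition into positive matchings survives the attachment of a leaf `u` to a
vertex `v`, as long as the degree of `v` does not exceed the number of parts: put the new edge into a
part that does not cover `v` and choose the weights at `u` freely. So only leafless graphs matter
(`positivelyColorable_of_leafless`). For them, counting edges and components bounds the excess
`∑ (deg v - 2)` over the nonisolated vertices by `2 (r - 1)`, where `r = |E| - |V| + c`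
(`IsLeafless.excess_add_two_le`). For `r = 0` there is no leafless graph with an edge, so a forest
needs only `Δ` parts. For `r = 1` all degrees are at most `2`; one edge from each component forms a
positive matching with a forest of maximum degree at most `2` as complement, which gives `3` parts.
For `r = 2` the excess is at most `2`, and removing an edge at a vertex of maximum degree leads back
to the previous case, because the excess of a leafless graph is even; this gives `4` parts. Finally
`r` is at most the number of cycles (`card_edgeSet_add_card_connectedComponent_le`), so the count of
cycles enters only through `r`.

*Algebra.* Let `E(G)` be the union of `d` successive positive matchings with weight functions `w l`.
Giving `x_{il}` the weight `w l i` in the `l`-th coordinate of `Fin d → ℝ`, ordered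
lexicographically, makes `x_{il} x_{jl}` the leading monomial of the generator of each edge `{i, j}`
in the `l`-th part. These monomials are squarefree and pairwise coprime, so the generators form a
Gröbner basis (`exists_degree_le_of_mem_span_image`), the ideal is radical (`isRadical_span_image`),
each generator is regular modulo the others, and the height is `|E(G)|`
(`card_le_height_span_image`). Conversely, a vertex of degree `Δ > d` allows to replace `Δ`
generators by `d` variables, so by Krull's height theorem the height is below `|E(G)|`, which is the
minimal number of generators because these are linearly independent quadrics
(`card_edgeSet_le_spanRank`).
-/

/-! ### Decompositions into positive matchings -/

/-- A weighted form of a decomposition of `E(G)` into `p` positive matchings: the edge `e` lies in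
the part `c e`, and `w l` is a weight function that exhibits the `l`-th part as a positive matching
of what is left after the removal of the earlier parts. -/
structure IsPositiveColoring {V : Type*} (G : SimpleGraph V) (p : ℕ) (c : Sym2 V → ℕ)
    (w : ℕ → V → ℝ) : Prop where
  lt : ∀ i j, G.Adj i j → c s(i, j) < p
  proper : ∀ i j k, G.Adj i j → G.Adj i k → j ≠ k → c s(i, j) ≠ c s(i, k)
  pos : ∀ i j, G.Adj i j → 0 < w (c s(i, j)) i + w (c s(i, j)) j
  neg : ∀ i j, G.Adj i j → ∀ l < c s(i, j), w l i + w l j < 0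

/-- `G` decomposes into `p` successive positive matchings, some of which may be empty. -/
def PositivelyColorable {V : Type*} (G : SimpleGraph V) (p : ℕ) : Prop :=
  ∃ c w, IsPositiveColoring G p c w

/-- No vertex has degree `1`. -/
def IsLeafless {V : Type*} (G : SimpleGraph V) : Prop :=
  ∀ v, (G.neighborSet v).ncard ≠ 1

section Coloring

variable {V : Type*} {G H : SimpleGraph V} {p q : ℕ}

theorem PositivelyColorable.mono (h : PositivelyColorable G p) (hpq : p ≤ q) :
    PositivelyColorable G q := by
  obtain ⟨c, w, h⟩ := h
  exact ⟨c, w, fun i j hij => (h.lt i j hij).trans_le hpq, h.proper, h.pos, h.neg⟩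

theorem positivelyColorable_bot : PositivelyColorable (⊥ : SimpleGraph V) p :=
  ⟨fun _ => 0, fun _ _ => 0, by simp, by simp, by simp, by simp⟩

theorem PositivelyColorable.pmd_le (h : PositivelyColorable G p) : pmd G ≤ p := by
  obtain ⟨c, w, h⟩ := h
  refine Nat.sInf_le ⟨fun l => {e | e ∈ G.edgeSet ∧ c e = l}, ?_, ?_, ?_⟩
  · ext e
    simp only [Set.mem_iUnion, Set.mem_ofPred_eq]
    constructor
    · rintro ⟨_, h, _⟩
      exact h
    · intro he
      induction e with | _ i j
      exact ⟨⟨c s(i, j), h.lt i j he⟩, he, rfl⟩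
  · intro i j hij
    rw [Set.disjoint_left]
    rintro e ⟨_, h1⟩ ⟨_, h2⟩
    exact hij (Fin.ext (h1.symm.trans h2))
  · intro l
    refine ⟨?_, ?_, w l, ?_, ?_⟩
    · rintro e ⟨he, hc⟩
      rw [SimpleGraph.edgeSet_deleteEdges]
      refine ⟨he, ?_⟩
      simp only [Set.mem_iUnion, Set.mem_ofPred_eq, not_exists, not_and]
      intro m hm _ h1
      exact hm.ne' (Fin.ext (hc.symm.trans h1))
    · rintro e ⟨he, hce⟩ f ⟨hf, hcf⟩ hef v hve hvf
      obtain ⟨a, rfl⟩ := Sym2.mem_iff_exists.1 hve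
      obtain ⟨b, rfl⟩ := Sym2.mem_iff_exists.1 hvf
      exact h.proper v a b he hf (by rintro rfl; exact hef rfl) (hce.trans hcf.symm)
    · rintro i j ⟨hij, hc⟩
      rw [← hc]
      exact h.pos i j hij
    · intro i j hij hM
      rw [SimpleGraph.deleteEdges_adj] at hij
      obtain ⟨hij, h1⟩ := hij
      refine h.neg i j hij l ?_
      simp only [Set.mem_iUnion, Set.mem_ofPred_eq, not_exists, not_and] at h1 hM
      by_contra! hle
      have hlt : c s(i, j) < l := lt_of_le_of_ne hle (hM hij)
      exact h1 ⟨c s(i, j), hlt.trans l.2⟩ hlt hij rfl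

/-- A positive matching can be put in front of a decomposition of the remaining edges. -/
theorem PositivelyColorable.cons {M : Set (Sym2 V)} (hM : IsPositiveMatching G M)
    (h : PositivelyColorable (G.deleteEdges M) p) : PositivelyColorable G (p + 1) := by
  classical
  obtain ⟨c, w, h⟩ := h
  obtain ⟨w₀, hpos, hneg⟩ := hM.exists_weight
  have hdel : ∀ {i j}, G.Adj i j → s(i, j) ∉ M → (G.deleteEdges M).Adj i j := fun hij h1 =>
    SimpleGraph.deleteEdges_adj.2 ⟨hij, h1⟩
  refine ⟨fun e => if e ∈ M then 0 else c e + 1, fun l => Nat.casesOn l w₀ w, ?_, ?_, ?_, ?_⟩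
  · intro i j hij
    split_ifs with h1
    · exact Nat.succ_pos p
    · exact Nat.succ_lt_succ (h.lt i j (hdel hij h1))
  · intro i j k hij hik hjk
    split_ifs with h1 h2 h2
    · exact absurd (Sym2.mem_mk_left i k)
        (hM.pairwise_disjoint _ h1 _ h2 (fun h => hjk (Sym2.congr_right.1 h)) i
          (Sym2.mem_mk_left i j))
    · exact (Nat.succ_ne_zero _).symm
    · exact Nat.succ_ne_zero _
    · exact fun h3 => h.proper i j k (hdel hij h1) (hdel hik h2) hjk (Nat.succ.inj h3)
  · intro i j hij
    dsimp only
    split_ifs with h1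
    · exact hpos i j h1
    · exact h.pos i j (hdel hij h1)
  · intro i j hij l
    dsimp only
    split_ifs with h1
    · exact fun hl => absurd hl (Nat.not_lt_zero l)
    · cases l with
      | zero => exact fun _ => hneg i j hij h1
      | succ l => exact fun hl => h.neg i j (hdel hij h1) l (Nat.lt_of_succ_lt_succ hl)

/-- A leaf `u` attached to `v` can be added to any part that does not cover `v`: in each weight
function the value at `u` can be chosen freely. -/
theorem PositivelyColorable.of_deleteEdges_leaf [Finite V] {u v : V} (huv : G.Adj u v)
    (hu : ∀ x, G.Adj u x → x = v) (hv : (G.neighborSet v).ncard ≤ p)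
    (h : PositivelyColorable (G.deleteEdges {s(u, v)}) p) : PositivelyColorable G p := by
  classical
  obtain ⟨c, w, h⟩ := h
  obtain ⟨a, hap, ha⟩ : ∃ a < p, ∀ x, G.Adj v x → x ≠ u → c s(v, x) ≠ a := by
    by_contra! hcon
    have hsub : (Set.Iio p) ⊆ (fun x => c s(v, x)) '' (G.neighborSet v \ {u}) := by
      intro a ha
      obtain ⟨x, h1, h2, h3⟩ := hcon a ha
      exact ⟨x, ⟨h1, h2⟩, h3⟩
    have h1 := Set.ncard_le_ncard hsub
    have h2 := Set.ncard_image_le (f := fun x => c s(v, x)) (Set.toFinite (G.neighborSet v \ {u}))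
    have h3 := Set.ncard_sdiff_singleton_lt_of_mem (show u ∈ G.neighborSet v from huv.symm)
    have h4 : (Set.Iio p).ncard = p := by
      rw [← Finset.coe_Iio, Set.ncard_coe_finset]
      simp
    omega
  have hne : u ≠ v := huv.ne
  -- the edges other than the one at the leaf
  have hold : ∀ i j, G.Adj i j → i ≠ u → j ≠ u →
      (G.deleteEdges {s(u, v)}).Adj i j ∧ s(i, j) ≠ s(u, v) := by
    intro i j hij hi hj
    have : s(i, j) ≠ s(u, v) := by
      intro h1
      rcases Sym2.eq_iff.1 h1 with ⟨h2, _⟩ | ⟨_, h2⟩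
      exacts [hi h2, hj h2]
    exact ⟨SimpleGraph.deleteEdges_adj.2 ⟨hij, this⟩, this⟩
  set c' : Sym2 V → ℕ := fun e => if e = s(u, v) then a else c e with hc'
  set w' : ℕ → V → ℝ := fun l => Function.update (w l) u ((if l = a then 1 else -1) - w l v) with hw'
  have hca : c' s(u, v) = a := if_pos rfl
  have hcold : ∀ i j, s(i, j) ≠ s(u, v) → c' s(i, j) = c s(i, j) := fun i j h1 => if_neg h1
  have hwu : ∀ l, w' l u = (if l = a then 1 else -1) - w l v := fun l => Function.update_self ..
  have hwo : ∀ l x, x ≠ u → w' l x = w l x := fun l x hx => Function.update_of_ne hx _ _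
  have hcase : ∀ i j, G.Adj i j → (i = u ∧ j = v) ∨ (i = v ∧ j = u) ∨ (i ≠ u ∧ j ≠ u) := by
    intro i j hij
    by_cases hi : i = u
    · subst hi
      exact Or.inl ⟨rfl, hu j hij⟩
    · by_cases hj : j = u
      · subst hj
        exact Or.inr (Or.inl ⟨hu i hij.symm, rfl⟩)
      · exact Or.inr (Or.inr ⟨hi, hj⟩)
  refine ⟨c', w', ?_, ?_, ?_, ?_⟩
  · intro i j hij
    rcases hcase i j hij with ⟨rfl, rfl⟩ | ⟨rfl, rfl⟩ | ⟨hi, hj⟩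
    · rwa [hca]
    · rwa [Sym2.eq_swap, hca]
    · obtain ⟨h1, h2⟩ := hold i j hij hi hj
      rw [hcold i j h2]
      exact h.lt i j h1
  · intro i j k hij hik hjk
    rcases hcase i j hij with ⟨rfl, rfl⟩ | ⟨rfl, rfl⟩ | ⟨hi, hj⟩
    · exact absurd (hu k hik).symm hjk
    · have h1 := (hold i k hik hne.symm hjk.symm).2
      rw [Sym2.eq_swap, hca, hcold i k h1]
      exact (ha k hik hjk.symm).symm
    · obtain ⟨h1, h2⟩ := hold i j hij hi hj
      rw [hcold i j h2]
      rcases hcase i k hik with ⟨rfl, rfl⟩ | ⟨rfl, rfl⟩ | ⟨_, hk⟩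
      · exact absurd rfl hi
      · rw [Sym2.eq_swap (a := i) (b := k), hca]
        exact ha j hij hj
      · obtain ⟨h3, h4⟩ := hold i k hik hi hk
        rw [hcold i k h4]
        exact h.proper i j k h1 h3 hjk
  · intro i j hij
    rcases hcase i j hij with ⟨rfl, rfl⟩ | ⟨rfl, rfl⟩ | ⟨hi, hj⟩
    · rw [hca, hwu, hwo _ _ hne.symm]
      simp
    · rw [Sym2.eq_swap, hca, hwu, hwo _ _ hne.symm]
      simp
    · obtain ⟨h1, h2⟩ := hold i j hij hi hj
      rw [hcold i j h2, hwo _ _ hi, hwo _ _ hj]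
      exact h.pos i j h1
  · intro i j hij l hl
    rcases hcase i j hij with ⟨rfl, rfl⟩ | ⟨rfl, rfl⟩ | ⟨hi, hj⟩
    · rw [hca] at hl
      rw [hwu, hwo _ _ hne.symm, if_neg hl.ne]
      norm_num
    · rw [Sym2.eq_swap, hca] at hl
      rw [hwu, hwo _ _ hne.symm, if_neg hl.ne]
      norm_num
    · obtain ⟨h1, h2⟩ := hold i j hij hi hj
      rw [hcold i j h2] at hl
      rw [hwo _ _ hi, hwo _ _ hj]
      exact h.neg i j h1 l hl

theorem ncard_neighborSet_mono [Finite V] (h : H ≤ G) (v : V) :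
    (H.neighborSet v).ncard ≤ (G.neighborSet v).ncard :=
  Set.ncard_le_ncard fun _ hx => h hx

theorem deleteEdges_singleton_lt {u v : V} (huv : G.Adj u v) : G.deleteEdges {s(u, v)} < G := by
  refine lt_of_le_of_ne (SimpleGraph.deleteEdges_le _) fun h => ?_
  have : (G.deleteEdges {s(u, v)}).Adj u v := by rwa [h]
  exact (SimpleGraph.deleteEdges_adj.1 this).2 rfl

/-- Leaves can be removed one at a time, so only leafless graphs need to be decomposed. -/
theorem positivelyColorable_of_leafless [Finite V] (P : SimpleGraph V → Prop)
    (hmono : ∀ G H, H ≤ G → P G → P H) (hdeg : ∀ G, P G → ∀ v, (G.neighborSet v).ncard ≤ p)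
    (hcore : ∀ G, P G → IsLeafless G → PositivelyColorable G p) (G : SimpleGraph V) (hG : P G) :
    PositivelyColorable G p := by
  induction G using WellFoundedLT.induction with
  | _ G ih =>
    by_cases hl : IsLeafless G
    · exact hcore G hG hl
    · simp only [IsLeafless, not_forall, not_not] at hl
      obtain ⟨u, hu⟩ := hl
      obtain ⟨v, hv⟩ := Set.ncard_eq_one.1 hu
      have huv : G.Adj u v := by
        rw [← SimpleGraph.mem_neighborSet, hv]
        rfl
      have hlt := deleteEdges_singleton_lt huv
      refine .of_deleteEdges_leaf huv (fun x hx => ?_) (hdeg G hG v)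
        (ih _ hlt (hmono _ _ hlt.le hG))
      rw [← SimpleGraph.mem_neighborSet, hv] at hx
      exact hx

/-- The hypothesis on leafless subgraphs says that `G` is a forest. -/
theorem positivelyColorable_of_forall_leafless_eq_bot [Finite V]
    (hG : ∀ H ≤ G, IsLeafless H → H = ⊥) (hp : ∀ v, (G.neighborSet v).ncard ≤ p) :
    PositivelyColorable G p := by
  refine positivelyColorable_of_leafless
    (fun G => (∀ H ≤ G, IsLeafless H → H = ⊥) ∧ ∀ v, (G.neighborSet v).ncard ≤ p)
    ?_ (fun G hG => hG.2) ?_ G ⟨hG, hp⟩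
  · exact fun G H hHG hG => ⟨fun K hK => hG.1 K (hK.trans hHG),
      fun v => (ncard_neighborSet_mono hHG v).trans (hG.2 v)⟩
  · intro G hG hl
    rw [hG.1 G le_rfl hl]
    exact positivelyColorable_bot

/-- Picking one edge from each component gives a positive matching. If every component is a cycle or
an isolated vertex, then what remains is a forest. -/
theorem exists_isPositiveMatching_of_ncard_neighborSet_le_two [Finite V]
    (hG : ∀ v, (G.neighborSet v).ncard ≤ 2) :
    ∃ M, IsPositiveMatching G M ∧ ∀ H ≤ G.deleteEdges M, IsLeafless H → H = ⊥ := by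
  classical
  have hex : ∀ C : G.ConnectedComponent, ∃ a b : V,
      (∃ x y, G.Adj x y ∧ G.connectedComponentMk x = C) →
        G.Adj a b ∧ G.connectedComponentMk a = C := by
    intro C
    by_cases h : ∃ x y, G.Adj x y ∧ G.connectedComponentMk x = C
    · obtain ⟨x, y, h1⟩ := h
      exact ⟨x, y, fun _ => h1⟩
    · obtain ⟨x, _⟩ := C.exists_rep
      exact ⟨x, x, fun h1 => absurd h1 h⟩
  choose a b hab using hex
  set κ := G.connectedComponentMk with hκ
  have hκadj : ∀ {x y}, G.Adj x y → κ x = κ y := fun h =>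
    SimpleGraph.ConnectedComponent.sound h.reachable
  set M : Set (Sym2 V) := {e | ∃ x y, G.Adj x y ∧ e = s(x, y) ∧ x = a (κ x) ∧ y = b (κ x)} with hM
  have hmem : ∀ e ∈ M, ∀ v ∈ e, e = s(a (κ v), b (κ v)) := by
    rintro e ⟨x, y, hxy, rfl, hx, hy⟩ v hv
    have : κ v = κ x := by
      rcases Sym2.mem_iff.1 hv with rfl | rfl
      exacts [rfl, (hκadj hxy).symm]
    rw [this, ← hx, ← hy]
  have hspec : ∀ e ∈ M, ∀ v ∈ e, v = a (κ v) ∨ v = b (κ v) := by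
    intro e he v hv
    have := hmem e he v hv
    rw [this] at hv
    exact Sym2.mem_iff.1 hv
  refine ⟨M, ⟨?_, ?_, fun x => if x = a (κ x) ∨ x = b (κ x) then 1 else -2, ?_, ?_⟩, ?_⟩
  · rintro e ⟨x, y, hxy, rfl, -⟩
    exact hxy
  · intro e he f hf hef v hve hvf
    exact hef ((hmem e he v hve).trans (hmem f hf v hvf).symm)
  · intro i j hij
    dsimp only
    rw [if_pos (hspec _ hij i (Sym2.mem_mk_left i j)), if_pos (hspec _ hij j (Sym2.mem_mk_right i j))]
    norm_num
  · intro i j hij hnot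
    dsimp only
    split_ifs with h1 h2 h2
    · exfalso
      have hk := hκadj hij
      rw [← hk] at h2
      rcases h1 with h1 | h1 <;> rcases h2 with h2 | h2
      · exact hij.ne (h1.trans h2.symm)
      · exact hnot ⟨i, j, hij, rfl, h1, h2⟩
      · exact hnot ⟨j, i, hij.symm, Sym2.eq_swap, hk ▸ h2, hk ▸ h1⟩
      · exact hij.ne (h1.trans h2.symm)
    all_goals norm_num
  · intro H hH hl
    have hHG : H ≤ G := hH.trans (SimpleGraph.deleteEdges_le _)
    -- a vertex that `H` meets has the same neighbours in `H` and in `G`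
    have hsat : ∀ {x y}, H.Adj x y → ∀ z, G.Adj x z → H.Adj x z := by
      intro x y hxy z hz
      have hpos : 0 < (H.neighborSet x).ncard := (Set.ncard_pos).2 ⟨y, hxy⟩
      have hne := hl x
      have heq : H.neighborSet x = G.neighborSet x :=
        Set.eq_of_subset_of_ncard_le (fun _ h => hHG h) ((hG x).trans (by omega))
      rw [← SimpleGraph.mem_neighborSet, heq]
      exact hz
    have hwalk : ∀ {x y}, G.Walk x y → (∃ z, H.Adj x z) → ∃ z, H.Adj y z := by
      intro x y p
      induction p with
      | nil => exact id
      | cons h _ ih =>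
        rintro ⟨z, hz⟩
        exact ih ⟨_, (hsat hz _ h).symm⟩
    rw [SimpleGraph.eq_bot_iff_forall_not_adj]
    intro x y hxy
    obtain ⟨h1, h2⟩ := hab (κ x) ⟨x, y, hHG hxy, rfl⟩
    obtain ⟨p⟩ := SimpleGraph.ConnectedComponent.exact h2
    obtain ⟨z, hz⟩ := hwalk p.reverse ⟨y, hxy⟩
    have h3 := hH (hsat hz _ h1)
    refine (SimpleGraph.deleteEdges_adj.1 h3).2 ⟨_, _, h1, rfl, ?_, ?_⟩
    · exact congrArg a h2.symm
    · exact congrArg b h2.symm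

/-- The hypothesis on leafless subgraphs says that every component of `G` has at most one cycle. -/
theorem positivelyColorable_of_forall_leafless_le_two [Finite V] (hp : 3 ≤ p)
    (hG : ∀ H ≤ G, IsLeafless H → ∀ v, (H.neighborSet v).ncard ≤ 2)
    (hdeg : ∀ v, (G.neighborSet v).ncard ≤ p) : PositivelyColorable G p := by
  refine positivelyColorable_of_leafless
    (fun G => (∀ H ≤ G, IsLeafless H → ∀ v, (H.neighborSet v).ncard ≤ 2) ∧
      ∀ v, (G.neighborSet v).ncard ≤ p) ?_ (fun G hG => hG.2) ?_ G ⟨hG, hdeg⟩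
  · exact fun G H hHG hG => ⟨fun K hK => hG.1 K (hK.trans hHG),
      fun v => (ncard_neighborSet_mono hHG v).trans (hG.2 v)⟩
  · intro G hG hl
    have h2 := hG.1 G le_rfl hl
    obtain ⟨M, hM, hrest⟩ := exists_isPositiveMatching_of_ncard_neighborSet_le_two h2
    refine (PositivelyColorable.cons hM (p := 2) ?_).mono hp
    exact positivelyColorable_of_forall_leafless_eq_bot hrest fun v =>
      (ncard_neighborSet_mono (SimpleGraph.deleteEdges_le _) v).trans (h2 v)

theorem isPositiveMatching_singleton {u v : V} (huv : G.Adj u v) :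
    IsPositiveMatching G {s(u, v)} := by
  classical
  refine ⟨by simpa using huv, ?_, fun x => if x ∈ s(u, v) then 1 else -2, ?_, ?_⟩
  · rintro e rfl f rfl h
    exact absurd rfl h
  · intro i j h
    rw [Set.mem_singleton_iff] at h
    simp only [← h, Sym2.mem_mk_left, Sym2.mem_mk_right, if_true]
    norm_num
  · intro i j hij h
    have : ¬ (i ∈ s(u, v) ∧ j ∈ s(u, v)) := fun hh => h ((Sym2.mem_and_mem_iff hij.ne).1 hh).symm
    dsimp only
    split_ifs with h1 h2 h2
    · exact absurd ⟨h1, h2⟩ this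
    all_goals norm_num

end Coloring

/-! ### Leafless graphs of small excess -/

section Excess

variable {V : Type*} [Fintype V] {G H : SimpleGraph V} {p : ℕ}

theorem sum_ncard_neighborSet (G : SimpleGraph V) :
    ∑ v, (G.neighborSet v).ncard = 2 * Nat.card G.edgeSet := by
  classical
  have h := G.sum_degrees_eq_twice_card_edges
  rw [← SimpleGraph.coe_edgeFinset, Nat.card_coe_set_eq, Set.ncard_coe_finset, ← h]
  refine Finset.sum_congr rfl fun v _ => ?_
  rw [← SimpleGraph.card_neighborFinset_eq_degree, ← Set.ncard_coe_finset,
    SimpleGraph.coe_neighborFinset]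

/-- The sum of `deg v - 2` over the nonisolated vertices of a leafless graph. The truncated
subtraction makes isolated vertices contribute `0`. -/
noncomputable def excess (G : SimpleGraph V) : ℕ := ∑ v, ((G.neighborSet v).ncard - 2)

theorem IsLeafless.excess_add (h : IsLeafless G) :
    excess G + 2 * Nat.card V = 2 * Nat.card G.edgeSet +
      2 * {v | (G.neighborSet v).ncard = 0}.ncard := by
  classical
  have h1 : {v | (G.neighborSet v).ncard = 0}.ncard =
      ∑ v : V, if (G.neighborSet v).ncard = 0 then 1 else 0 := by
    rw [Finset.sum_boole, Set.ncard_eq_toFinset_card']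
    simp
  rw [h1, ← sum_ncard_neighborSet, excess, Finset.mul_sum, ← Finset.sum_add_distrib,
    Nat.card_eq_fintype_card, ← Finset.card_univ, mul_comm 2, ← smul_eq_mul,
    ← Finset.sum_const, ← Finset.sum_add_distrib]
  refine Finset.sum_congr rfl fun v _ => ?_
  have := h v
  split_ifs <;> omega

theorem IsLeafless.even_excess (h : IsLeafless G) : Even (excess G) := by
  have := h.excess_add
  rw [Nat.even_iff]
  omega

theorem ncard_neighborSet_le_of_excess_eq_zero (h : excess G = 0) (v : V) :
    (G.neighborSet v).ncard ≤ 2 := by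
  have := (Finset.sum_eq_zero_iff.1 h) v (Finset.mem_univ v)
  omega

/-- Removing an edge at a vertex of degree at least `3` lowers the excess, which is even for leafless
graphs, so the remaining graph has only components with at most one cycle. -/
theorem positivelyColorable_of_forall_leafless_excess_le_two (hp : 4 ≤ p)
    (hG : ∀ H ≤ G, IsLeafless H → excess H ≤ 2)
    (hdeg : ∀ v, (G.neighborSet v).ncard ≤ p) : PositivelyColorable G p := by
  classical
  refine positivelyColorable_of_leafless
    (fun G => (∀ H ≤ G, IsLeafless H → excess H ≤ 2) ∧
      ∀ v, (G.neighborSet v).ncard ≤ p) ?_ (fun G hG => hG.2) ?_ G ⟨hG, hdeg⟩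
  · exact fun G H hHG hG => ⟨fun K hK => hG.1 K (hK.trans hHG),
      fun v => (ncard_neighborSet_mono hHG v).trans (hG.2 v)⟩
  intro G hG hl
  by_cases h2 : ∀ v, (G.neighborSet v).ncard ≤ 2
  · exact positivelyColorable_of_forall_leafless_le_two (by omega)
      (fun H hH _ v => (ncard_neighborSet_mono hH v).trans (h2 v)) hG.2
  push Not at h2
  obtain ⟨v₀, hv₀⟩ := h2
  obtain ⟨v, -, hmax⟩ := Finset.exists_max_image Finset.univ (fun v => (G.neighborSet v).ncard)
    ⟨v₀, Finset.mem_univ v₀⟩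
  have hv : 2 < (G.neighborSet v).ncard := hv₀.trans_le (hmax v₀ (Finset.mem_univ _))
  have hexc := hG.1 G le_rfl hl
  obtain ⟨u, hu⟩ : (G.neighborSet v).Nonempty := Set.nonempty_of_ncard_ne_zero (by omega)
  have hvu : G.Adj v u := hu
  have hle := (deleteEdges_singleton_lt hvu).le
  have hdrop : ∀ H ≤ G.deleteEdges {s(v, u)},
      (H.neighborSet v).ncard < (G.neighborSet v).ncard := by
    intro H hH
    refine Set.ncard_lt_ncard (Set.ssubset_iff_of_subset (fun x hx => hle (hH hx)) |>.2
      ⟨u, hvu, fun h => (SimpleGraph.deleteEdges_adj.1 (hH h)).2 rfl⟩)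
  -- two vertices of degree above `3`, or one of degree above `4`, would give excess above `2`
  have h4 : (G.neighborSet v).ncard ≤ 4 := by
    have := Finset.single_le_sum (f := fun v => (G.neighborSet v).ncard - 2) (fun _ _ => Nat.zero_le _)
      (Finset.mem_univ v)
    have h5 : (G.neighborSet v).ncard - 2 ≤ excess G := this
    omega
  have h3 : ∀ x ≠ v, (G.neighborSet x).ncard ≤ 3 := by
    intro x hx
    by_contra! hcon
    have h5 : ∑ y ∈ {x, v}, ((G.neighborSet y).ncard - 2) ≤ excess G :=
      Finset.sum_le_sum_of_subset (Finset.subset_univ _)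
    rw [Finset.sum_pair hx] at h5
    omega
  refine (PositivelyColorable.cons (isPositiveMatching_singleton hvu) (p := 3) ?_).mono hp
  refine positivelyColorable_of_forall_leafless_le_two le_rfl ?_ ?_
  · intro H hH hHl
    refine ncard_neighborSet_le_of_excess_eq_zero ?_
    have h6 : excess H < excess G := by
      refine Finset.sum_lt_sum (fun x _ => ?_) ⟨v, Finset.mem_univ v, ?_⟩
      · exact Nat.sub_le_sub_right (ncard_neighborSet_mono (hH.trans hle) x) 2
      · have := hdrop H hH
        omega
    have h7 := Nat.even_iff.1 hHl.even_excess
    omega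
  · intro x
    by_cases hx : x = v
    · subst hx
      have := hdrop _ le_rfl
      omega
    · exact (ncard_neighborSet_mono hle x).trans (h3 x hx)

end Excess

/-! ### Edges, components and cycles -/

section Cyclomatic

open SimpleGraph

variable {V : Type*} {G H : SimpleGraph V}

/-- A walk that uses the edge `uv` links both of its ends to `u` or `v` once that edge is removed. -/
theorem reachable_deleteEdges_or {u v x y : V} (h : G.Reachable x y) :
    (G.deleteEdges {s(u, v)}).Reachable x y ∨
      ((G.deleteEdges {s(u, v)}).Reachable x u ∨ (G.deleteEdges {s(u, v)}).Reachable x v) ∧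
      ((G.deleteEdges {s(u, v)}).Reachable y u ∨ (G.deleteEdges {s(u, v)}).Reachable y v) := by
  obtain ⟨p⟩ := h
  induction p with
  | nil => exact Or.inl (Reachable.refl _)
  | @cons x z y h _ ih =>
    by_cases he : s(x, z) = s(u, v)
    · have hx : (G.deleteEdges {s(u, v)}).Reachable x u ∨
          (G.deleteEdges {s(u, v)}).Reachable x v := by
        rcases Sym2.eq_iff.1 he with ⟨rfl, _⟩ | ⟨rfl, _⟩
        exacts [Or.inl (Reachable.refl _), Or.inr (Reachable.refl _)]
      have hz : (G.deleteEdges {s(u, v)}).Reachable z u ∨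
          (G.deleteEdges {s(u, v)}).Reachable z v := by
        rcases Sym2.eq_iff.1 he with ⟨_, rfl⟩ | ⟨_, rfl⟩
        exacts [Or.inr (Reachable.refl _), Or.inl (Reachable.refl _)]
      refine Or.inr ⟨hx, ?_⟩
      rcases ih with h1 | h1
      · exact hz.imp h1.symm.trans h1.symm.trans
      · exact h1.2
    · have hxz : (G.deleteEdges {s(u, v)}).Reachable x z :=
        (deleteEdges_adj.2 ⟨h, he⟩ : (G.deleteEdges {s(u, v)}).Adj x z).reachable
      exact ih.imp hxz.trans fun h1 => ⟨h1.1.imp hxz.trans hxz.trans, h1.2⟩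

theorem map_ofLE_injective (h : H ≤ G) :
    Function.Injective (Subgraph.map (Hom.ofLE h)) := by
  intro A B hAB
  ext x y
  · have := congrArg (fun S => x ∈ S.verts) hAB
    simpa using this
  · have := congrArg (fun S => S.Adj x y) hAB
    simpa [Relation.Map] using this

theorem IsCycleSubgraph.map_ofLE (h : H ≤ G) {A : H.Subgraph} (hA : IsCycleSubgraph A) :
    IsCycleSubgraph (A.map (Hom.ofLE h)) := by
  obtain ⟨v, p, hp, rfl⟩ := hA
  exact ⟨v, p.mapLe h, hp.mapLe h, Walk.toSubgraph_map _ _⟩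

variable [Finite V]

theorem card_edgeSet_deleteEdges_singleton_add_one {u v : V} (huv : G.Adj u v) :
    Nat.card (G.deleteEdges {s(u, v)}).edgeSet + 1 = Nat.card G.edgeSet := by
  rw [edgeSet_deleteEdges, Nat.card_coe_set_eq, Nat.card_coe_set_eq]
  exact Set.ncard_sdiff_singleton_add_one (by exact huv)

theorem card_connectedComponent_deleteEdges_singleton_le (u v : V) :
    Nat.card (G.deleteEdges {s(u, v)}).ConnectedComponent ≤ Nat.card G.ConnectedComponent + 1 := by
  classical
  set G' := G.deleteEdges {s(u, v)} with hG'
  rw [← Finite.card_option]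
  refine Nat.card_le_card_of_injective (fun C : G'.ConnectedComponent =>
    if C = G'.connectedComponentMk u then none
    else some (C.map (Hom.ofLE (deleteEdges_le _)))) ?_
  intro C D
  induction C using ConnectedComponent.ind with | _ x
  induction D using ConnectedComponent.ind with | _ y
  dsimp only
  split_ifs with h1 h2 h2
  · exact fun _ => h1.trans h2.symm
  · simp
  · simp
  · intro h
    have hr : G.Reachable x y := ConnectedComponent.exact (Option.some.inj h)
    rw [ConnectedComponent.eq] at h1 h2 ⊢
    rcases reachable_deleteEdges_or (u := u) (v := v) hr with h3 | ⟨h3, h4⟩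
    · exact h3
    · exact (h3.resolve_left h1).trans (h4.resolve_left h2).symm

theorem card_connectedComponent_lt_deleteEdges_singleton {u v : V} (huv : G.Adj u v)
    (h : ¬ (G.deleteEdges {s(u, v)}).Reachable u v) :
    Nat.card G.ConnectedComponent + 1 ≤ Nat.card (G.deleteEdges {s(u, v)}).ConnectedComponent := by
  have hle : G.deleteEdges {s(u, v)} ≤ G := deleteEdges_le _
  have := Fintype.ofFinite G.ConnectedComponent
  have := Fintype.ofFinite (G.deleteEdges {s(u, v)}).ConnectedComponent
  rw [Nat.card_eq_fintype_card, Nat.card_eq_fintype_card]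
  refine Fintype.card_lt_of_surjective_not_injective _ (ConnectedComponent.surjective_map_ofLE hle)
    fun hinj => h ?_
  exact ConnectedComponent.exact (@hinj (connectedComponentMk _ u) (connectedComponentMk _ v)
    (ConnectedComponent.sound huv.reachable))

/-- `|E| + c` is monotone: a new edge lowers the number of components by at most one. -/
theorem card_edgeSet_add_card_connectedComponent_mono (h : H ≤ G) :
    Nat.card H.edgeSet + Nat.card H.ConnectedComponent ≤
      Nat.card G.edgeSet + Nat.card G.ConnectedComponent := by
  induction G using WellFoundedLT.induction with
  | _ G ih =>
    rcases h.eq_or_lt with rfl | hlt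
    · rfl
    obtain ⟨u, v, huv, hnot⟩ : ∃ u v, G.Adj u v ∧ ¬ H.Adj u v := by
      by_contra! hcon
      exact hlt.not_ge fun u v => hcon u v
    have hH : H ≤ G.deleteEdges {s(u, v)} := by
      intro x y hxy
      refine deleteEdges_adj.2 ⟨h hxy, fun he => hnot ?_⟩
      rwa [← mem_edgeSet, ← Set.mem_singleton_iff.1 he, mem_edgeSet]
    have h1 := ih _ (deleteEdges_singleton_lt huv) hH
    have h2 := card_edgeSet_deleteEdges_singleton_add_one huv
    have h3 := card_connectedComponent_deleteEdges_singleton_le (G := G) u v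
    omega

/-- The cyclomatic number is at most the number of cycles: removing an edge that lies on a cycle
lowers the former by one and the latter by at least one, and removing a bridge changes neither. -/
theorem card_edgeSet_add_card_connectedComponent_le (G : SimpleGraph V) :
    Nat.card G.edgeSet + Nat.card G.ConnectedComponent ≤
      Nat.card V + {A : G.Subgraph | IsCycleSubgraph A}.ncard := by
  induction G using WellFoundedLT.induction with
  | _ G ih =>
    by_cases hbot : ∃ u v, G.Adj u v
    · obtain ⟨u, v, huv⟩ := hbot
      have hle := (deleteEdges_singleton_lt huv).le
      have h1 := ih _ (deleteEdges_singleton_lt huv)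
      have h2 := card_edgeSet_deleteEdges_singleton_add_one huv
      set S := Subgraph.map (Hom.ofLE hle) ''
        {A : (G.deleteEdges {s(u, v)}).Subgraph | IsCycleSubgraph A} with hS
      have h3 : S.ncard = _ := Set.ncard_image_of_injective _ (map_ofLE_injective hle)
      have hsub : S ⊆ {A : G.Subgraph | IsCycleSubgraph A} := by
        rintro _ ⟨A, hA, rfl⟩
        exact hA.map_ofLE hle
      by_cases hr : (G.deleteEdges {s(u, v)}).Reachable u v
      · obtain ⟨x, p, hp, he⟩ := adj_and_reachable_delete_edges_iff_exists_cycle.1 ⟨huv, hr⟩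
        have h4 : S.ncard < {A : G.Subgraph | IsCycleSubgraph A}.ncard := by
          refine Set.ncard_lt_ncard (Set.ssubset_iff_of_subset hsub |>.2
            ⟨p.toSubgraph, ⟨x, p, hp, rfl⟩, ?_⟩)
          rintro ⟨A, -, hA⟩
          have hadj : p.toSubgraph.Adj u v := Walk.adj_toSubgraph_iff_mem_edges.2 he
          rw [← hA, Subgraph.map_adj] at hadj
          obtain ⟨a, b, hab, ha, hb⟩ := hadj
          have h4 : A.Adj u v := (show a = u from ha) ▸ (show b = v from hb) ▸ hab
          exact (deleteEdges_adj.1 h4.adj_sub).2 rfl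
        have h5 := ConnectedComponent.card_le_card_of_le hle
        omega
      · have h4 := Set.ncard_le_ncard hsub
        have h5 := card_connectedComponent_lt_deleteEdges_singleton huv hr
        omega
    · push Not at hbot
      have h1 : Nat.card G.edgeSet = 0 := by
        rw [eq_bot_iff_forall_not_adj.2 hbot]
        simp
      have h2 : Nat.card G.ConnectedComponent ≤ Nat.card V :=
        Nat.card_le_card_of_surjective G.connectedComponentMk Quot.mk_surjective
      omega

/-- A leafless graph with an edge has, besides its isolated vertices, at least one more component,
so its excess is at most `2 (r - 1)` where `r` is the cyclomatic number. -/
theorem IsLeafless.excess_add_two_le [Fintype V] {r : ℕ} (hl : IsLeafless G) (hne : G ≠ ⊥)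
    (hr : Nat.card G.edgeSet + Nat.card G.ConnectedComponent ≤ Nat.card V + r) :
    excess G + 2 ≤ 2 * r := by
  obtain ⟨x, y, hxy⟩ : ∃ x y, G.Adj x y := by
    by_contra! hcon
    exact hne (eq_bot_iff_forall_not_adj.2 hcon)
  set S := {v | (G.neighborSet v).ncard = 0} with hS
  have hiso : ∀ v ∈ S, ∀ z, ¬ G.Adj v z := by
    intro v hv z hz
    have : z ∈ (∅ : Set V) := (Set.ncard_eq_zero (Set.toFinite _)).1 hv ▸ (show z ∈ G.neighborSet v from hz)
    exact this
  have hxS : x ∉ S := fun h => hiso x h y hxy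
  have hreach : ∀ v ∈ S, ∀ z, G.Reachable v z → v = z := by
    rintro v hv z ⟨p⟩
    cases p with
    | nil => rfl
    | cons h _ => exact absurd h (hiso v hv _)
  have hcard : S.ncard + 1 ≤ Nat.card G.ConnectedComponent := by
    rw [← Set.ncard_insert_of_notMem hxS, ← Nat.card_coe_set_eq]
    refine Nat.card_le_card_of_injective
      (fun v : (insert x S : Set V) => G.connectedComponentMk v.1) ?_
    rintro ⟨a, ha⟩ ⟨b, hb⟩ hab
    have hab' : G.Reachable a b := ConnectedComponent.exact hab
    refine Subtype.ext ?_
    rcases ha with rfl | ha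
    · rcases hb with rfl | hb
      · rfl
      · exact (hreach b hb _ hab'.symm).symm
    · exact hreach a ha _ hab'
  have : excess G + 2 * Nat.card V = 2 * Nat.card G.edgeSet + 2 * S.ncard := hl.excess_add
  omega

theorem positivelyColorable_of_cyclomatic_le_one [Fintype V] {p : ℕ} (hp : 3 ≤ p)
    (hr : Nat.card G.edgeSet + Nat.card G.ConnectedComponent ≤ Nat.card V + 1)
    (hdeg : ∀ v, (G.neighborSet v).ncard ≤ p) : PositivelyColorable G p := by
  refine positivelyColorable_of_forall_leafless_le_two hp (fun H hH hl v => ?_) hdeg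
  by_cases hbot : H = ⊥
  · simp [hbot, neighborSet]
  · have := hl.excess_add_two_le hbot
      ((card_edgeSet_add_card_connectedComponent_mono hH).trans hr)
    exact ncard_neighborSet_le_of_excess_eq_zero (by omega) v

theorem positivelyColorable_of_cyclomatic_le_two [Fintype V] {p : ℕ} (hp : 4 ≤ p)
    (hr : Nat.card G.edgeSet + Nat.card G.ConnectedComponent ≤ Nat.card V + 2)
    (hdeg : ∀ v, (G.neighborSet v).ncard ≤ p) : PositivelyColorable G p := by
  refine positivelyColorable_of_forall_leafless_excess_le_two hp (fun H hH hl => ?_) hdeg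
  by_cases hbot : H = ⊥
  · simp [hbot, excess, neighborSet]
  · have := hl.excess_add_two_le hbot
      ((card_edgeSet_add_card_connectedComponent_mono hH).trans hr)
    omega

end Cyclomatic

/-! ### Ideals with coprime squarefree leading monomials -/

section Groebner

open MvPolynomial MonomialOrder
open scoped MonomialOrder

/-- A total order on the monomials that is compatible with multiplication and refines divisibility is
a monomial order; by Dickson's lemma it is a well-order. Such orders are given here by an injective
monotone homomorphism into an ordered cancellative monoid. -/
noncomputable def monomialOrderOfInjective {σ : Type*} [Finite σ] {Γ : Type*} [AddCommMonoid Γ]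
    [LinearOrder Γ] [IsOrderedAddMonoid Γ] (φ : (σ →₀ ℕ) →+ Γ)
    (hφ : Function.Injective φ) (hmono : Monotone φ) : MonomialOrder σ where
  syn := AddMonoidHom.mrange φ
  addCommMonoidSyn := (AddMonoidHom.mrange φ).toAddCommMonoid
  toSyn := AddEquiv.ofBijective φ.mrangeRestrict
    ⟨fun _ _ h => hφ (congrArg Subtype.val h), φ.mrangeRestrict_surjective⟩
  toSyn_monotone := fun _ _ h => hmono h
  wellFoundedLT_syn := by
    have : WellQuasiOrderedLE (AddMonoidHom.mrange φ) :=
      Monotone.wellQuasiOrderedLE_of_wellQuasiOrderedLE_of_surjective (f := φ.mrangeRestrict)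
        (fun _ _ h => hmono h) φ.mrangeRestrict_surjective
    infer_instance

theorem monomialOrderOfInjective_lt {σ : Type*} [Finite σ] {Γ : Type*} [AddCommMonoid Γ]
    [LinearOrder Γ] [IsOrderedAddMonoid Γ] (φ : (σ →₀ ℕ) →+ Γ)
    (hφ : Function.Injective φ) (hmono : Monotone φ) {a b : σ →₀ ℕ} :
    a ≺[monomialOrderOfInjective φ hφ hmono] b ↔ φ a < φ b := Iff.rfl

variable {σ : Type*} {m : MonomialOrder σ} {k : Type*} [Field k] {ι : Type*}
  {f : ι → MvPolynomial σ k}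

/-- Division by a family of nonzero polynomials. -/
theorem exists_sub_mem_span_image (hf : ∀ i, f i ≠ 0) (s : Set ι) (g : MvPolynomial σ k) :
    ∃ r, g - r ∈ Ideal.span (f '' s) ∧ ∀ c ∈ r.support, ∀ i ∈ s, ¬ m.degree (f i) ≤ c := by
  obtain ⟨h, r, h1, -, h2⟩ := m.div_set (B := f '' s)
    (by rintro _ ⟨i, -, rfl⟩; exact (m.leadingCoeff_ne_zero_iff.2 (hf i)).isUnit) g
  refine ⟨r, ?_, fun c hc i hi => h2 c hc _ ⟨i, hi, rfl⟩⟩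
  rw [h1, add_sub_cancel_right]
  rw [Finsupp.linearCombination_apply]
  exact Submodule.sum_mem _ fun b _ => Ideal.mul_mem_left _ _ (Ideal.subset_span b.2)

/-- Buchberger's coprimality criterion: if the leading monomials have pairwise disjoint supports, then
every nonzero element of the ideal has a leading monomial divisible by one of them. -/
theorem exists_degree_le_of_mem_span_image (hf : ∀ i, f i ≠ 0)
    (hcop : ∀ i j, i ≠ j → ∀ x, m.degree (f i) x = 0 ∨ m.degree (f j) x = 0)
    (s : Finset ι) {g : MvPolynomial σ k} (hg : g ∈ Ideal.span (f '' s)) (hg0 : g ≠ 0) :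
    ∃ i ∈ s, m.degree (f i) ≤ m.degree g := by
  classical
  induction s using Finset.induction_on generalizing g with
  | empty => simp_all
  | insert j s hj ih =>
    rw [Finset.coe_insert, Set.image_insert_eq, Ideal.mem_span_insert] at hg
    obtain ⟨h, a, ha, rfl⟩ := hg
    -- the cofactor of `f j` may be taken to be reduced modulo the other generators
    obtain ⟨r, hr, hred⟩ := exists_sub_mem_span_image (m := m) hf (s : Set ι) h
    set b := (h - r) * f j + a with hb
    have hbmem : b ∈ Ideal.span (f '' s) := Ideal.add_mem _ (Ideal.mul_mem_right _ _ hr) ha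
    have hsum : h * f j + a = r * f j + b := by rw [hb]; ring
    rw [hsum] at hg0 ⊢
    by_cases hr0 : r = 0
    · rw [hr0, zero_mul, zero_add] at hg0 ⊢
      obtain ⟨i, hi, hle⟩ := ih hbmem hg0
      exact ⟨i, Finset.mem_insert_of_mem hi, hle⟩
    have hdeg : m.degree (r * f j) = m.degree r + m.degree (f j) := m.degree_mul hr0 (hf j)
    by_cases hb0 : b = 0
    · rw [hb0, add_zero, hdeg]
      exact ⟨j, Finset.mem_insert_self j s, le_add_self⟩
    obtain ⟨i, hi, hle⟩ := ih hbmem hb0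
    -- the two leading monomials differ, so they cannot cancel
    have hne : m.degree (r * f j) ≠ m.degree b := by
      intro heq
      refine hred _ (m.degree_mem_support hr0) i hi fun x => ?_
      have hx := hle x
      rw [← heq, hdeg, Finsupp.add_apply] at hx
      rcases hcop i j (by rintro rfl; exact hj hi) x with h0 | h0 <;> omega
    rcases lt_or_gt_of_ne (m.toSyn.injective.ne hne) with hlt | hlt
    · rw [m.degree_add_eq_right_of_lt hlt]
      exact ⟨i, Finset.mem_insert_of_mem hi, hle⟩
    · rw [m.degree_add_of_lt hlt, hdeg]
      exact ⟨j, Finset.mem_insert_self j s, le_add_self⟩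

/-- An ideal with a squarefree initial ideal is radical. -/
theorem isRadical_span_image (hf : ∀ i, f i ≠ 0)
    (hcop : ∀ i j, i ≠ j → ∀ x, m.degree (f i) x = 0 ∨ m.degree (f j) x = 0)
    (hsq : ∀ i x, m.degree (f i) x ≤ 1) (s : Finset ι) : (Ideal.span (f '' s)).IsRadical := by
  rintro g ⟨n, hn⟩
  obtain ⟨r, hr, hred⟩ := exists_sub_mem_span_image (m := m) hf (s : Set ι) g
  have hrn : r ^ n ∈ Ideal.span (f '' s) := by
    have h1 : g ^ n - r ^ n ∈ Ideal.span (f '' s) :=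
      Ideal.mem_of_dvd _ (sub_dvd_pow_sub_pow g r n) hr
    have := Ideal.sub_mem _ hn h1
    rwa [sub_sub_cancel] at this
  by_cases hr0 : r = 0
  · rwa [hr0, sub_zero] at hr
  obtain ⟨i, hi, hle⟩ := exists_degree_le_of_mem_span_image hf hcop s hrn (pow_ne_zero n hr0)
  refine absurd (fun x => ?_) (hred _ (m.degree_mem_support hr0) i hi)
  have h1 := hle x
  rw [m.degree_pow, Finsupp.smul_apply, smul_eq_mul] at h1
  have h2 := hsq i x
  rcases Nat.eq_zero_or_pos (m.degree r x) with h3 | h3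
  · rwa [h3, mul_zero, ← h3] at h1
  · omega

/-- Each generator is regular modulo the ideal spanned by any of the others. -/
theorem mem_span_image_of_mul_mem (hf : ∀ i, f i ≠ 0)
    (hcop : ∀ i j, i ≠ j → ∀ x, m.degree (f i) x = 0 ∨ m.degree (f j) x = 0)
    (s : Finset ι) {j : ι} (hj : j ∉ s) {g : MvPolynomial σ k}
    (hg : g * f j ∈ Ideal.span (f '' s)) : g ∈ Ideal.span (f '' s) := by
  obtain ⟨r, hr, hred⟩ := exists_sub_mem_span_image (m := m) hf (s : Set ι) g
  have hrn : r * f j ∈ Ideal.span (f '' s) := by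
    have := Ideal.sub_mem _ hg (Ideal.mul_mem_right (f j) _ hr)
    rwa [← sub_mul, sub_sub_cancel] at this
  by_cases hr0 : r = 0
  · rwa [hr0, sub_zero] at hr
  obtain ⟨i, hi, hle⟩ :=
    exists_degree_le_of_mem_span_image hf hcop s hrn (mul_ne_zero hr0 (hf j))
  refine absurd (fun x => ?_) (hred _ (m.degree_mem_support hr0) i hi)
  have hx := hle x
  rw [m.degree_mul hr0 (hf j), Finsupp.add_apply] at hx
  rcases hcop i j (by rintro rfl; exact hj hi) x with h0 | h0 <;> omega

/-- Minimal primes consist of zero divisors, so adding an element that is regular modulo `I` raises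
the height. -/
theorem height_add_one_le_of_regular {R : Type*} [CommRing R] {I J : Ideal R} (hIJ : I ≤ J) {x : R}
    (hx : x ∈ J) (hreg : ∀ y, y * x ∈ I → y ∈ I) : I.height + 1 ≤ J.height := by
  rw [Ideal.height_eq_inf_minimalPrimes J]
  refine le_iInf₂ fun P hP => ?_
  have hPp : P.IsPrime := hP.1.1
  obtain ⟨Q, hQ, hQP⟩ := Ideal.exists_minimalPrimes_le (hIJ.trans hP.1.2)
  have hQp : Q.IsPrime := hQ.1.1
  have hxQ : x ∉ Q := by
    intro hxQ
    obtain ⟨y, hy, hxy⟩ := Ideal.exists_mul_mem_of_mem_minimalPrimes hQ hxQ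
    exact hy (hreg y (mul_comm x y ▸ hxy))
  have hlt : Q < P := lt_of_le_of_ne hQP (by rintro rfl; exact hxQ (hP.1.2 hx))
  refine le_trans ?_ (Ideal.height_add_one_le_of_lt_of_isPrime hlt)
  gcongr
  exact hQ.1.2

theorem card_le_height_span_image (hf : ∀ i, f i ≠ 0)
    (hcop : ∀ i j, i ≠ j → ∀ x, m.degree (f i) x = 0 ∨ m.degree (f j) x = 0) (s : Finset ι) :
    (s.card : ℕ∞) ≤ (Ideal.span (f '' s)).height := by
  classical
  induction s using Finset.induction_on with
  | empty => simp
  | insert j s hj ih =>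
    rw [Finset.card_insert_of_notMem hj, Nat.cast_add, Nat.cast_one]
    refine le_trans (add_le_add_left ih 1) (height_add_one_le_of_regular (x := f j)
      (Ideal.span_mono (Set.image_mono ?_)) (Ideal.subset_span ⟨j, ?_, rfl⟩)
      fun y => mem_span_image_of_mul_mem hf hcop s hj)
    · simp
    · simp

end Groebner

/-! ### Monomial orders from weights -/

section WeightOrder

universe u v

variable {σ : Type u} {Γ : Type v} [AddCommGroup Γ]

/-- Compare monomials first by total degree, then by the weight `ω`, then by `m`. -/
noncomputable def weightEmbedding (m : MonomialOrder σ) (ω : (σ →₀ ℕ) →+ Γ) :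
    (σ →₀ ℕ) →+ Lex (ℕ × Lex (Γ × m.syn)) where
  toFun a := toLex (a.degree, toLex (ω a, m.toSyn a))
  map_zero' := by simp
  map_add' a b := by simp only [map_add]; rfl

theorem weightEmbedding_injective (m : MonomialOrder σ) (ω : (σ →₀ ℕ) →+ Γ) :
    Function.Injective (weightEmbedding m ω) := by
  intro a b h
  have h1 : (a.degree, toLex (ω a, m.toSyn a)) = (b.degree, toLex (ω b, m.toSyn b)) := h
  have h2 : (ω a, m.toSyn a) = (ω b, m.toSyn b) := (Prod.ext_iff.1 h1).2
  exact m.toSyn.injective (Prod.ext_iff.1 h2).2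

theorem weightEmbedding_monotone [LinearOrder Γ] (m : MonomialOrder σ) (ω : (σ →₀ ℕ) →+ Γ) :
    Monotone (weightEmbedding m ω) := by
  intro a b h
  rcases h.eq_or_lt with rfl | hlt
  · rfl
  obtain ⟨c, rfl⟩ := exists_add_of_le h
  refine le_of_lt (Prod.Lex.toLex_lt_toLex.2 (Or.inl ?_))
  have hc : c ≠ 0 := by
    rintro rfl
    simp at hlt
  have : c.degree ≠ 0 := fun h => hc (Finsupp.degree_eq_zero_iff _ |>.1 h)
  simp only [map_add]
  omega

open scoped MonomialOrder in
/-- Every weight with values in an ordered group is compatible with a monomial order in each total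
degree. -/
theorem exists_monomialOrder_of_weight [Finite σ] [LinearOrder Γ] [IsOrderedAddMonoid Γ]
    (ω : (σ →₀ ℕ) →+ Γ) :
    ∃ m : MonomialOrder.{u, max u v} σ, ∀ a b : σ →₀ ℕ, a.degree = b.degree → ω a < ω b → a ≺[m] b := by
  obtain ⟨n, ⟨φ⟩⟩ := Finite.exists_equiv_fin σ
  let _ : LinearOrder σ := LinearOrder.lift' φ φ.injective
  refine ⟨monomialOrderOfInjective (weightEmbedding MonomialOrder.lex ω)
    (weightEmbedding_injective MonomialOrder.lex ω) (weightEmbedding_monotone MonomialOrder.lex ω),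
    fun a b h1 h2 => ?_⟩
  rw [monomialOrderOfInjective_lt]
  exact Prod.Lex.toLex_lt_toLex.2 (Or.inr ⟨h1, Prod.Lex.toLex_lt_toLex.2 (Or.inl h2)⟩)

end WeightOrder

/-! ### Generators and height of the Lovász–Saks–Schrijver ideal -/

section EdgePolynomials

open MvPolynomial

variable {V : Type*} {G : SimpleGraph V} {d : ℕ} (k : Type*) [Field k]

/-- The monomial `x_{il} x_{jl}` for `e = {i, j}`. -/
noncomputable def edgeMonomial (e : Sym2 V) (l : Fin d) : V × Fin d →₀ ℕ :=
  Sym2.lift ⟨fun i j => Finsupp.single (i, l) 1 + Finsupp.single (j, l) 1,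
    fun _ _ => add_comm _ _⟩ e

theorem edgeMonomial_mk (i j : V) (l : Fin d) :
    edgeMonomial s(i, j) l = Finsupp.single (i, l) 1 + Finsupp.single (j, l) 1 := rfl

/-- The generator `∑ l, x_{il} x_{jl}` of the Lovász–Saks–Schrijver ideal for `e = {i, j}`. -/
noncomputable def edgePolynomial (d : ℕ) (e : Sym2 V) : MvPolynomial (V × Fin d) k :=
  ∑ l : Fin d, monomial (edgeMonomial e l) 1

theorem edgePolynomial_mk (i j : V) :
    edgePolynomial k d s(i, j) = ∑ l : Fin d, X (i, l) * X (j, l) := by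
  simp [edgePolynomial, edgeMonomial_mk, X, monomial_mul]

theorem lssIdeal_eq_span (G : SimpleGraph V) (d : ℕ) :
    lssIdeal k G d = Ideal.span (edgePolynomial k d '' G.edgeSet) := by
  rw [lssIdeal]
  congr 1
  ext f
  constructor
  · rintro ⟨i, j, hij, rfl⟩
    exact ⟨s(i, j), hij, edgePolynomial_mk k i j⟩
  · rintro ⟨e, he, rfl⟩
    induction e with | _ i j
    exact ⟨i, j, he, edgePolynomial_mk k i j⟩

open Classical in
theorem edgeMonomial_apply {e : Sym2 V} (he : e ∈ G.edgeSet) (l : Fin d) (x : V × Fin d) :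
    edgeMonomial e l x = if x.1 ∈ e ∧ x.2 = l then 1 else 0 := by
  induction e with | _ i j
  have hne : i ≠ j := SimpleGraph.Adj.ne he
  obtain ⟨v, l'⟩ := x
  simp only [edgeMonomial_mk, Finsupp.add_apply, Finsupp.single_apply, Prod.mk.injEq, Sym2.mem_iff]
  grind

theorem degree_edgeMonomial (e : Sym2 V) (l : Fin d) : (edgeMonomial e l).degree = 2 := by
  induction e with | _ i j
  simp [edgeMonomial_mk]

theorem edgeMonomial_injective {e e' : Sym2 V} (he : e ∈ G.edgeSet) (he' : e' ∈ G.edgeSet)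
    {l l' : Fin d} (h : edgeMonomial e l = edgeMonomial e' l') : e = e' ∧ l = l' := by
  have key : ∀ x : V × Fin d, (x.1 ∈ e ∧ x.2 = l) ↔ (x.1 ∈ e' ∧ x.2 = l') := by
    intro x
    have := DFunLike.congr_fun h x
    rw [edgeMonomial_apply he, edgeMonomial_apply he'] at this
    split_ifs at this with h1 h2 h2
    exacts [iff_of_true h1 h2, iff_of_false h1 h2]
  obtain ⟨v, hv⟩ : ∃ v, v ∈ e := ⟨_, Sym2.out_fst_mem e⟩
  have hl : l = l' := ((key (v, l)).1 ⟨hv, rfl⟩).2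
  subst hl
  exact ⟨Sym2.ext fun v => by simpa using key (v, l), rfl⟩

open Classical in
theorem coeff_edgeMonomial_edgePolynomial {e e' : Sym2 V} (he : e ∈ G.edgeSet)
    (he' : e' ∈ G.edgeSet) (l : Fin d) :
    coeff (edgeMonomial e l) (edgePolynomial k d e') = if e = e' then 1 else 0 := by
  rw [edgePolynomial, coeff_sum]
  simp only [coeff_monomial]
  split_ifs with h
  · subst h
    rw [Finset.sum_eq_single l]
    · simp
    · intro l' _ hl
      exact if_neg fun h => hl (edgeMonomial_injective he he h).2
    · simp
  · exact Finset.sum_eq_zero fun l' _ => if_neg fun h1 => h (edgeMonomial_injective he' he h1).1.symm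

theorem edgePolynomial_mem (d : ℕ) (e : Sym2 V) :
    edgePolynomial k d e ∈ idealOfVars (V × Fin d) k ^ 2 :=
  Submodule.sum_mem _ fun l _ =>
    (monomial_mem_pow_idealOfVars_iff 2 _ one_ne_zero).2 (degree_edgeMonomial e l).ge

theorem lssIdeal_le_idealOfVars_sq (G : SimpleGraph V) (d : ℕ) :
    lssIdeal k G d ≤ idealOfVars (V × Fin d) k ^ 2 := by
  rw [lssIdeal_eq_span, Ideal.span_le]
  rintro _ ⟨e, -, rfl⟩
  exact edgePolynomial_mem k d e

theorem idealOfVars_ne_top (σ : Type*) : idealOfVars σ k ≠ ⊤ := by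
  rw [Ideal.ne_top_iff_one, ← pow_one (idealOfVars σ k), ← C_1, C_mem_pow_idealOfVars_iff]
  simp

theorem lssIdeal_ne_top (G : SimpleGraph V) (d : ℕ) : lssIdeal k G d ≠ ⊤ := fun h =>
  idealOfVars_ne_top k (V × Fin d) <| top_le_iff.1 <| h ▸
    (lssIdeal_le_idealOfVars_sq k G d).trans (Ideal.pow_le_self two_ne_zero)

/-- On the square of the ideal of the variables, multiplication by `a` acts on the coefficients in
degree two through the constant term of `a`. -/
theorem coeff_mul_of_mem_sq {σ : Type*} {g : MvPolynomial σ k} (hg : g ∈ idealOfVars σ k ^ 2)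
    (a : MvPolynomial σ k) {u : σ →₀ ℕ} (hu : u.degree = 2) :
    coeff u (a * g) = constantCoeff a * coeff u g := by
  have h1 : a - C (constantCoeff a) ∈ idealOfVars σ k ^ 1 := by
    rw [mem_pow_idealOfVars_iff']
    intro x hx
    have : x = 0 := (Finsupp.degree_eq_zero_iff _).1 (by omega)
    subst this
    simp [constantCoeff_eq]
  have h2 : (a - C (constantCoeff a)) * g ∈ idealOfVars σ k ^ 3 := by
    have := Ideal.mul_mem_mul h1 hg
    rwa [← pow_add] at this
  have h3 := (mem_pow_idealOfVars_iff' 3 _).1 h2 u (by omega)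
  rw [sub_mul, coeff_sub, coeff_C_mul] at h3
  exact sub_eq_zero.1 h3

/-- The generators are linearly independent quadrics, so none can be dispensed with. -/
theorem card_edgeSet_le_spanRank [Finite V] (G : SimpleGraph V) (hd : 0 < d) :
    (Nat.card G.edgeSet : ℕ∞) ≤ (lssIdeal k G d).spanRank.toENat := by
  classical
  have := Fintype.ofFinite G.edgeSet
  let φ : lssIdeal k G d →ₛₗ[(constantCoeff : MvPolynomial (V × Fin d) k →+* k)]
      (G.edgeSet → k) :=
    { toFun := fun g e => coeff (edgeMonomial e.1 ⟨0, hd⟩) g.1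
      map_add' := fun g h => by ext; simp
      map_smul' := fun a g => by
        ext e
        exact coeff_mul_of_mem_sq k (lssIdeal_le_idealOfVars_sq k G d g.2) a
          (degree_edgeMonomial _ _) }
  have : RingHomSurjective (constantCoeff : MvPolynomial (V × Fin d) k →+* k) :=
    ⟨fun x => ⟨C x, constantCoeff_C _ x⟩⟩
  have htop : Submodule.map φ ⊤ = ⊤ := by
    rw [eq_top_iff, ← (Pi.basisFun k G.edgeSet).span_eq, Submodule.span_le]
    rintro _ ⟨e, rfl⟩
    refine ⟨⟨edgePolynomial k d e.1, ?_⟩, trivial, ?_⟩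
    · rw [lssIdeal_eq_span]
      exact Ideal.subset_span ⟨e.1, e.2, rfl⟩
    · ext e'
      change coeff _ _ = _
      rw [coeff_edgeMonomial_edgePolynomial k e'.2 e.2, Pi.basisFun_apply, Pi.single_apply]
      simp only [Subtype.ext_iff]
  have h1 := Submodule.lift_spanRank_map_le φ ⊤
  rw [htop, Submodule.spanRank_top, ← Submodule.rank_eq_spanRank_of_free, rank_fun'] at h1
  have h2 := Cardinal.toENat.monotone' h1
  simpa using h2

theorem encard_edgePolynomial_image_le [Finite V] (S : Set (Sym2 V)) :
    (edgePolynomial k d '' S).encard ≤ (S.ncard : ℕ∞) := by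
  rw [S.toFinite.cast_ncard_eq]
  exact Set.encard_image_le _ _

theorem spanRank_toENat_span_le {R : Type*} [CommRing R] (S : Set R) :
    (Ideal.span S).spanRank.toENat ≤ S.encard :=
  Cardinal.toENat.monotone' (Submodule.spanRank_span_le_card S)

theorem spanRank_lssIdeal_le [Finite V] (G : SimpleGraph V) :
    (lssIdeal k G d).spanRank.toENat ≤ (Nat.card G.edgeSet : ℕ∞) := by
  rw [lssIdeal_eq_span, Nat.card_coe_set_eq]
  exact (spanRank_toENat_span_le _).trans (encard_edgePolynomial_image_le k _)

/-- Setting the `d` variables at a vertex `v` to zero kills the generators of all edges at `v`. -/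
theorem height_lssIdeal_add_ncard_le [Finite V] (G : SimpleGraph V) (v : V) :
    (lssIdeal k G d).height + (G.neighborSet v).ncard ≤ d + Nat.card G.edgeSet := by
  classical
  set J : Ideal (MvPolynomial (V × Fin d) k) :=
    Ideal.span (Set.range (fun l : Fin d => X (v, l)) ∪
      edgePolynomial k d '' (G.edgeSet \ G.incidenceSet v)) with hJ
  have hIJ : lssIdeal k G d ≤ J := by
    rw [lssIdeal_eq_span, Ideal.span_le]
    rintro _ ⟨e, he, rfl⟩
    by_cases hv : e ∈ G.incidenceSet v
    · obtain ⟨w, rfl⟩ := Sym2.mem_iff_exists.1 hv.2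
      rw [edgePolynomial_mk]
      exact Submodule.sum_mem _ fun l _ =>
        Ideal.mul_mem_right _ _ (Ideal.subset_span (Or.inl ⟨l, rfl⟩))
    · exact Ideal.subset_span (Or.inr ⟨e, ⟨he, hv⟩, rfl⟩)
  have hJtop : J ≠ ⊤ := by
    refine fun h => idealOfVars_ne_top k (V × Fin d) (top_le_iff.1 (h ▸ ?_))
    rw [hJ, Ideal.span_le, Set.union_subset_iff]
    constructor
    · rintro _ ⟨l, rfl⟩
      exact Ideal.subset_span ⟨_, rfl⟩
    · rintro _ ⟨e, -, rfl⟩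
      exact Ideal.pow_le_self two_ne_zero (edgePolynomial_mem k d e)
  have hcard : (G.edgeSet \ G.incidenceSet v).ncard + (G.neighborSet v).ncard =
      Nat.card G.edgeSet := by
    have h1 := Set.ncard_sdiff_add_ncard_of_subset (G.incidenceSet_subset v)
    have h2 : (G.incidenceSet v).ncard = (G.neighborSet v).ncard := by
      rw [← Nat.card_coe_set_eq, ← Nat.card_coe_set_eq]
      exact Nat.card_congr (G.incidenceSetEquivNeighborSet v)
    rw [Nat.card_coe_set_eq, ← h1, h2]
  have hrange : (Set.range (fun l : Fin d => (X (v, l) : MvPolynomial (V × Fin d) k))).encard ≤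
      (d : ℕ∞) := by
    rw [← Set.image_univ]
    exact (Set.encard_image_le _ _).trans (by simp)
  have hle : (lssIdeal k G d).height ≤ d + (G.edgeSet \ G.incidenceSet v).ncard :=
    calc (lssIdeal k G d).height ≤ J.height := Ideal.height_mono hIJ
      _ ≤ J.spanRank.toENat := J.height_le_spanRank_toENat hJtop
      _ ≤ _ := spanRank_toENat_span_le _
      _ ≤ _ := Set.encard_union_le _ _
      _ ≤ _ := add_le_add hrange (encard_edgePolynomial_image_le k _)
  calc _ ≤ (d + (G.edgeSet \ G.incidenceSet v).ncard : ℕ∞) + (G.neighborSet v).ncard :=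
        add_le_add_left hle _
    _ = _ := by rw [← hcard, Nat.cast_add, add_assoc]

theorem ncard_neighborSet_le_of_isCompleteIntersectionIdeal [Finite V] (hd : 0 < d)
    (h : IsCompleteIntersectionIdeal (lssIdeal k G d)) (v : V) : (G.neighborSet v).ncard ≤ d := by
  have h1 := card_edgeSet_le_spanRank k G hd
  rw [h] at h1
  have h2 := (add_le_add_left h1 ((G.neighborSet v).ncard : ℕ∞)).trans
    (height_lssIdeal_add_ncard_le k G v)
  have h3 : Nat.card G.edgeSet + (G.neighborSet v).ncard ≤ d + Nat.card G.edgeSet := by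
    exact_mod_cast h2
  omega

end EdgePolynomials

/-! ### Leading monomials from positive matchings -/

section PositiveColoring

open MvPolynomial
open scoped MonomialOrder

universe u

variable {V : Type u} {G : SimpleGraph V} {d : ℕ} {c : Sym2 V → ℕ} {w : ℕ → V → ℝ}

/-- The weight of `x_{il}` is `w l i`, placed in the `l`-th coordinate of `Fin d → ℝ` with the
lexicographic order. An earlier part has priority over a later one, so `x_{il} x_{jl}` is heaviest
for the part `l` that contains the edge. -/
noncomputable def coloringWeight (d : ℕ) (w : ℕ → V → ℝ) :
    (V × Fin d →₀ ℕ) →+ Lex (Fin d → ℝ) :=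
  Finsupp.weight fun x => toLex (Pi.single x.2 (w x.2 x.1))

theorem coloringWeight_edgeMonomial (i j : V) (l : Fin d) :
    coloringWeight d w (edgeMonomial s(i, j) l) = toLex (Pi.single l (w l i + w l j)) := by
  rw [edgeMonomial_mk, map_add]
  simp only [coloringWeight, Finsupp.weight_single, one_smul]
  rw [Pi.single_add]
  rfl

theorem IsPositiveColoring.exists_monomialOrder [Finite V] (h : IsPositiveColoring G d c w) (k : Type*)
    [Field k] : ∃ m : MonomialOrder.{u, u} (V × Fin d), ∀ e ∈ G.edgeSet, ∃ l : Fin d, c e = l ∧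
      m.degree (edgePolynomial k d e) = edgeMonomial e l := by
  classical
  obtain ⟨m, hm⟩ := exists_monomialOrder_of_weight (coloringWeight d w)
  refine ⟨m, fun e he => ⟨⟨c e, ?_⟩, rfl, ?_⟩⟩
  · induction e with | _ i j
    exact h.lt i j he
  set l₀ : Fin d := ⟨c e, _⟩ with hl₀
  have hlt : ∀ l, l ≠ l₀ → edgeMonomial e l ≺[m] edgeMonomial e l₀ := by
    intro l hl
    refine hm _ _ ((degree_edgeMonomial _ _).trans (degree_edgeMonomial _ _).symm) ?_
    induction e with | _ i j
    rw [coloringWeight_edgeMonomial, coloringWeight_edgeMonomial]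
    have hpos : 0 < w l₀ i + w l₀ j := h.pos i j he
    rcases lt_or_gt_of_ne hl with h1 | h1
    · refine ⟨l, fun x hx => ?_, ?_⟩
      · simp [hx.ne, (hx.trans h1).ne]
      · have := h.neg i j he l h1
        simpa [Pi.single_apply, hl] using this
    · refine ⟨l₀, fun x hx => ?_, ?_⟩
      · simp [hx.ne, (hx.trans h1).ne]
      · simpa [Pi.single_apply, hl.symm] using hpos
  refine m.toSyn.injective (le_antisymm ?_ ?_)
  · rw [m.degree_le_iff]
    intro u hu
    rw [edgePolynomial] at hu
    obtain ⟨l, -, hl⟩ := Finset.mem_biUnion.1 (support_sum hu)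
    rw [Finset.mem_singleton.1 (support_monomial_subset hl)]
    by_cases hll : l = l₀
    · rw [hll]
    · exact (hlt l hll).le
  · refine m.le_degree (mem_support_iff.2 ?_)
    rw [coeff_edgeMonomial_edgePolynomial k he he, if_pos rfl]
    exact one_ne_zero

/-- If `E(G)` decomposes into `d` positive matchings, then the generators of `L_G(d)` have pairwise
coprime squarefree leading monomials. -/
theorem PositivelyColorable.isRadical_and_card_le_height [Finite V] (h : PositivelyColorable G d) (k : Type*)
    [Field k] :
    (lssIdeal k G d).IsRadical ∧ (Nat.card G.edgeSet : ℕ∞) ≤ (lssIdeal k G d).height := by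
  classical
  obtain ⟨c, w, h⟩ := h
  obtain ⟨m, hm⟩ := h.exists_monomialOrder k
  have := Fintype.ofFinite G.edgeSet
  set f : G.edgeSet → MvPolynomial (V × Fin d) k := fun e => edgePolynomial k d e with hf
  have hI : lssIdeal k G d = Ideal.span (f '' (Finset.univ : Finset G.edgeSet)) := by
    rw [lssIdeal_eq_span, Finset.coe_univ, Set.image_univ]
    congr 1
    ext g
    simp [hf]
  have hne : ∀ e, f e ≠ 0 := by
    intro e h0
    obtain ⟨l, -, -⟩ := hm e.1 e.2
    have := coeff_edgeMonomial_edgePolynomial k e.2 e.2 l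
    rw [if_pos rfl, show edgePolynomial k d e.1 = 0 from h0, coeff_zero] at this
    exact zero_ne_one this
  have hcop : ∀ e e', e ≠ e' → ∀ x, m.degree (f e) x = 0 ∨ m.degree (f e') x = 0 := by
    rintro ⟨e, he⟩ ⟨e', he'⟩ hee ⟨v, l⟩
    obtain ⟨l₁, hl₁, h1⟩ := hm e he
    obtain ⟨l₂, hl₂, h2⟩ := hm e' he'
    simp only [hf, h1, h2, edgeMonomial_apply he, edgeMonomial_apply he']
    by_contra! hcon
    simp only [ne_eq, ite_eq_right_iff, one_ne_zero, imp_false, not_not] at hcon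
    obtain ⟨⟨hv, hl⟩, hv', hl'⟩ := hcon
    obtain ⟨a, rfl⟩ := Sym2.mem_iff_exists.1 hv
    obtain ⟨b, rfl⟩ := Sym2.mem_iff_exists.1 hv'
    refine h.proper v a b he he' (by rintro rfl; exact hee rfl) ?_
    rw [hl₁, hl₂, ← hl, ← hl']
  have hsq : ∀ e x, m.degree (f e) x ≤ 1 := by
    rintro ⟨e, he⟩ x
    obtain ⟨l, -, h1⟩ := hm e he
    simp only [hf, h1, edgeMonomial_apply he]
    split_ifs <;> omega
  rw [hI]
  refine ⟨isRadical_span_image hne hcop hsq _, ?_⟩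
  rw [Nat.card_eq_fintype_card, ← Finset.card_univ]
  exact card_le_height_span_image hne hcop _

theorem PositivelyColorable.isCompleteIntersectionIdeal [Finite V] (h : PositivelyColorable G d) (k : Type*)
    [Field k] : IsCompleteIntersectionIdeal (lssIdeal k G d) :=
  le_antisymm ((spanRank_lssIdeal_le k G).trans (h.isRadical_and_card_le_height k).2)
    (Ideal.height_le_spanRank_toENat _ (lssIdeal_ne_top k G d))

end PositiveColoring

/-- If every number `p ≥ q` that bounds the degrees of `G` is the length of a decomposition into
positive matchings, then all claims about `G` follow. -/
theorem pmd_le_and_lssIdeal {k : Type*} [Field k] {V : Type*} [Fintype V] (G : SimpleGraph V)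
    [DecidableRel G.Adj] {q : ℕ} (hq : 0 < q)
    (h : ∀ p, q ≤ p → (∀ v, (G.neighborSet v).ncard ≤ p) → PositivelyColorable G p) :
    pmd G ≤ max q G.maxDegree ∧
      ∀ d : ℕ, q ≤ d →
        (IsCompleteIntersectionIdeal (lssIdeal k G d) ↔ G.maxDegree ≤ d) ∧
        (G.maxDegree ≤ d → (lssIdeal k G d).IsRadical) := by
  have hdeg : ∀ v, (G.neighborSet v).ncard = G.degree v := fun v => by
    rw [← SimpleGraph.card_neighborFinset_eq_degree, ← Set.ncard_coe_finset,
      SimpleGraph.coe_neighborFinset]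
  have hcol : ∀ d, q ≤ d → G.maxDegree ≤ d → PositivelyColorable G d := fun d hqd hd =>
    h d hqd fun v => (hdeg v).trans_le ((G.degree_le_maxDegree v).trans hd)
  refine ⟨(hcol _ (le_max_left _ _) (le_max_right _ _)).pmd_le, fun d hd => ⟨⟨fun hci => ?_,
    fun hle => (hcol d hd hle).isCompleteIntersectionIdeal k⟩,
    fun hle => ((hcol d hd hle).isRadical_and_card_le_height k).1⟩⟩
  exact G.maxDegree_le_of_forall_degree_le d fun v => (hdeg v).symm.trans_le
    (ncard_neighborSet_le_of_isCompleteIntersectionIdeal k (hq.trans_le hd) hci v)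

theorem theorem1 {k : Type*} [Field k] {V : Type*} [Fintype V] (G : SimpleGraph V)
    [DecidableRel G.Adj] :
    (IsUnicyclic G →
      pmd G ≤ max 3 G.maxDegree ∧
      ∀ d : ℕ, 3 ≤ d →
        (IsCompleteIntersectionIdeal (lssIdeal k G d) ↔ G.maxDegree ≤ d) ∧
        (G.maxDegree ≤ d → (lssIdeal k G d).IsRadical)) ∧
    (IsBicyclic G ∨ HasCyclomaticNumberTwo G →
      pmd G ≤ max 4 G.maxDegree ∧
      ∀ d : ℕ, 4 ≤ d →
        (IsCompleteIntersectionIdeal (lssIdeal k G d) ↔ G.maxDegree ≤ d) ∧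
        (G.maxDegree ≤ d → (lssIdeal k G d).IsRadical)) := by
  refine ⟨fun hG => ?_, fun hG => ?_⟩
  · have hr := card_edgeSet_add_card_connectedComponent_le G
    rw [IsUnicyclic] at hG
    rw [hG] at hr
    exact pmd_le_and_lssIdeal G (by norm_num) fun p hp =>
      positivelyColorable_of_cyclomatic_le_one hp hr
  · have hr : Nat.card G.edgeSet + Nat.card G.ConnectedComponent ≤ Nat.card V + 2 := by
      rcases hG with hG | hG
      · have := card_edgeSet_add_card_connectedComponent_le G
        rw [IsBicyclic] at hG
        rwa [hG] at this
      · exact hG.le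
    exact pmd_le_and_lssIdeal G (by norm_num) fun p hp =>
      positivelyColorable_of_cyclomatic_le_two hp hr
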